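/- Identify the Hardy space $H^2$ of the unit disk $\mathbb D$ with the closed subspace of $L^2(\partial\mathbb D)$ (normalized Lebesgue measure) of functions whose Fourier coefficients with negative indices vanish. A function $\alpha$ is inner if it is bounded and analytic in $\mathbb D$ and its radial boundary values exist and have modulus $1$ a.e. on $\partial\mathbb D$. For inner $\alpha$ let $K_\alpha=H^2\ominus\alpha H^2$, let $P_\alpha$ be the orthogonal projection of $L^2(\partial\mathbb D)$ onto $K_\alpha$, and let $K_\alpha^\infty$ be the (dense) subspace of bounded functions in $K_\alpha$. For inner $\alpha,\beta$ and $\varphi\in L^2(\partial\mathbb D)$ let $A^{\alpha,\beta}_\varphi f=P_\beta(\varphi f)$, $f\in K_\alpha^\infty$. If this densely defined operator is bounded, it is identified with its bounded extension $K_\alpha\to K_\beta$. Let $\mathcal T(\alpha,\beta)$ be the set of all bounded operators $K_\alpha\to K_\beta$ of the form $A^{\alpha,\beta}_\varphi$ with $\varphi\in L^2(\partial\mathbb D)$. For $w\in\mathbb D$ put $\alpha_w=\dfrac{w-\alpha}{1-\bar w\alpha}$, which is again inner, and let the Crofoot transform $J_w^\alpha:K_\alpha\to K_{\alpha_w}$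 be the invertible operator $J_w^\alpha f=\dfrac{\sqrt{1-|w|^2}}{1-\bar w\alpha}\,f$. Proposition. Let $\alpha,\beta$ be inner functions, let $a,b\in\mathbb D$, and let $A:K_\alpha\to K_\beta$ be a bounded linear operator. Then $A\in\mathcal T(\alpha,\beta)$ if and only if $J_b^\beta A(J_a^\alpha)^{-1}\in\mathcal T(\alpha_a,\beta_b)$. Moreover, for every $\varphi\in L^2(\partial\mathbb D)$ with $A=A^{\alpha,\beta}_\varphi$ one has $J_b^\beta A(J_a^\alpha)^{-1}=A^{\alpha_a,\beta_b}_\phi$, where $$\phi=\frac{(1-\bar a\alpha)(1-b\bar\beta)}{\sqrt{1-|a|^2}\,\sqrt{1-|b|^2}}\,\varphi\quad\text{on }\partial\mathbb D.$$ -/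

import Mathlib

open MeasureTheory Filter Topology
open scoped ComplexConjugate ENNReal

noncomputable section

namespace ATTO

instance factTwoPiPos : Fact (0 < 2 * Real.pi) := ⟨Real.two_pi_pos⟩

/-- The unit circle, parametrized by `t ↦ e^{it}`, `t ∈ ℝ / 2πℤ`. -/
abbrev Circ : Type := AddCircle (2 * Real.pi)

/-- Normalized Lebesgue measure `dt / 2π` on the unit circle. -/
abbrev circMeasure : Measure Circ := AddCircle.haarAddCircle

/-- The Hilbert space `L²` of the unit circle. -/
abbrev L2 : Type := Lp ℂ 2 circMeasure

/-- The radial boundary function `e^{it} ↦ lim_{r → 1⁻} α(r e^{it})`. -/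
def bdry (α : ℂ → ℂ) (t : Circ) : ℂ :=
  limUnder (𝓝[<] (1 : ℝ)) fun r : ℝ => α ((r : ℂ) * (AddCircle.toCircle t : ℂ))

/-- Inner functions: bounded analytic functions on the open unit disk whose radial boundary
values exist and have modulus one almost everywhere on the unit circle. -/
structure IsInner (α : ℂ → ℂ) : Prop where
  analytic : DifferentiableOn ℂ α (Metric.ball 0 1)
  bounded : ∃ C : ℝ, ∀ z ∈ Metric.ball (0 : ℂ) 1, ‖α z‖ ≤ C
  unimodular : ∀ᵐ t ∂circMeasure, ∃ l : ℂ, ‖l‖ = 1 ∧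
    Tendsto (fun r : ℝ => α ((r : ℂ) * (AddCircle.toCircle t : ℂ))) (𝓝[<] (1 : ℝ)) (𝓝 l)

/-- The Hardy space `H²`, as the subspace of `L²` of the functions whose Fourier coefficients
with negative indices vanish. -/
def hardy : Submodule ℂ L2 where
  carrier := {f | ∀ n : ℤ, n < 0 → fourierCoeff f n = 0}
  zero_mem' := by
    intro n _
    rw [fourierCoeff_congr_ae (Lp.coeFn_zero ℂ 2 circMeasure)]
    simp [fourierCoeff]
  add_mem' := by
    intro f g hf hg n hn
    rw [← fourierBasis_repr, map_add, lp.coeFn_add, Pi.add_apply, fourierBasis_repr,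
      fourierBasis_repr, hf n hn, hg n hn, add_zero]
  smul_mem' := by
    intro c f hf n hn
    rw [← fourierBasis_repr, map_smul, lp.coeFn_smul, Pi.smul_apply, fourierBasis_repr,
      hf n hn, smul_zero]

/-- The subspace `α H²` of `L²`. -/
def mulHardy (α : ℂ → ℂ) : Submodule ℂ L2 where
  carrier := {f | ∃ h ∈ hardy, f =ᵐ[circMeasure] fun t => bdry α t * h t}
  zero_mem' := ⟨0, zero_mem _, by
    filter_upwards [Lp.coeFn_zero ℂ 2 circMeasure] with t _
    simp⟩
  add_mem' := by
    rintro f g ⟨h, hh, hf⟩ ⟨k, hk, hg⟩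
    refine ⟨h + k, add_mem hh hk, ?_⟩
    filter_upwards [hf, hg, Lp.coeFn_add f g, Lp.coeFn_add h k] with t h1 h2 h3 h4
    rw [h3, h4, Pi.add_apply, Pi.add_apply, h1, h2, mul_add]
  smul_mem' := by
    rintro c f ⟨h, hh, hf⟩
    refine ⟨c • h, Submodule.smul_mem _ _ hh, ?_⟩
    filter_upwards [hf, Lp.coeFn_smul c f, Lp.coeFn_smul c h] with t h1 h2 h3
    rw [h2, h3, Pi.smul_apply, Pi.smul_apply, h1, smul_eq_mul, smul_eq_mul]
    ring

/-- The model space `K_α = H² ⊖ α H²`. -/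
def modelSpace (α : ℂ → ℂ) : Submodule ℂ L2 := hardy ⊓ (mulHardy α)ᗮ

theorem isClosed_hardy : IsClosed (hardy : Set L2) := by
  have h : (hardy : Set L2) =
      ⋂ n : ℤ, ⋂ _ : n < 0, {f : L2 | inner ℂ (fourierLp 2 n : L2) f = 0} := by
    ext f
    simp only [Set.mem_iInter, Set.mem_ofPred_eq]
    refine forall₂_congr fun n _ => ?_
    rw [← fourierBasis_repr, HilbertBasis.repr_apply_apply, coe_fourierBasis]
  rw [h]
  exact isClosed_iInter fun n => isClosed_iInter fun _ =>
    isClosed_eq (by fun_prop) continuous_const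

instance completeSpace_hardy : CompleteSpace hardy := isClosed_hardy.completeSpace_coe

instance completeSpace_modelSpace (α : ℂ → ℂ) : CompleteSpace (modelSpace α) :=
  (isClosed_hardy.inter (Submodule.isClosed_orthogonal _)).completeSpace_coe

/-- Multiplication on `L²` by an essentially bounded function `g`. -/
def mulOp (g : Circ → ℂ) (hg : MemLp g ∞ circMeasure) : L2 →L[ℂ] L2 :=
  (ContinuousLinearMap.mul ℂ ℂ).holderL circMeasure ∞ 2 2 (hg.toLp g)

theorem mulOp_ae (g : Circ → ℂ) (hg : MemLp g ∞ circMeasure) (f : L2) :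
    mulOp g hg f =ᵐ[circMeasure] fun t => g t * f t := by
  have h := ContinuousLinearMap.coeFn_holder (r := 2) (ContinuousLinearMap.mul ℂ ℂ)
    (hg.toLp g) f
  filter_upwards [h, hg.coeFn_toLp] with t h1 h2
  simp only [mulOp, ContinuousLinearMap.holderL_apply_apply]
  rw [h1, h2]
  rfl

/-- `K_α^∞`, the subspace of the bounded functions in `K_α`. -/
def boundedPart (α : ℂ → ℂ) : Submodule ℂ (modelSpace α) where
  carrier := {f | MemLp (f : L2) ∞ circMeasure}
  zero_mem' := by
    exact (memLp_congr_ae (Lp.coeFn_zero ℂ 2 circMeasure)).2 MemLp.zero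
  add_mem' := by
    intro f g hf hg
    exact (memLp_congr_ae (Lp.coeFn_add (f : L2) (g : L2))).2 (hf.add hg)
  smul_mem' := by
    intro c f hf
    exact (memLp_congr_ae (Lp.coeFn_smul c (f : L2))).2 (hf.const_smul c)

/-- The asymmetric truncated Toeplitz operator `A_φ^{α,β} f = P_β (φ f)` with symbol `φ ∈ L²`,
as a (possibly unbounded) operator from `K_α` into `K_β` with domain `K_α^∞`. -/
def atto (α β : ℂ → ℂ) (φ : L2) : modelSpace α →ₗ.[ℂ] modelSpace β where
  domain := boundedPart α
  toFun :=
    { toFun := fun f => (modelSpace β).orthogonalProjectionOnto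
        (mulOp ((f : modelSpace α) : L2) f.2 φ)
      map_add' := by
        intro f g
        rw [← map_add]
        congr 1
        apply Lp.ext
        filter_upwards [mulOp_ae _ (f + g).2 φ, mulOp_ae _ f.2 φ, mulOp_ae _ g.2 φ,
          Lp.coeFn_add (mulOp _ f.2 φ) (mulOp _ g.2 φ),
          Lp.coeFn_add ((f : modelSpace α) : L2) ((g : modelSpace α) : L2)] with t h1 h2 h3 h4 h5
        rw [h1, h4, Pi.add_apply, h2, h3, ← add_mul]
        exact congrArg (· * φ t) h5
      map_smul' := by
        intro c f
        rw [RingHom.id_apply, ← map_smul]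
        congr 1
        apply Lp.ext
        filter_upwards [mulOp_ae _ (c • f).2 φ, mulOp_ae _ f.2 φ,
          Lp.coeFn_smul c (mulOp _ f.2 φ),
          Lp.coeFn_smul c ((f : modelSpace α) : L2)] with t h1 h2 h3 h4
        rw [h1, h3, Pi.smul_apply, h2, smul_eq_mul, ← mul_assoc]
        exact congrArg (· * φ t) h4 }

/-- `A = A_φ^{α,β}`: the operator `A_φ^{α,β}`, densely defined on `K_α^∞`, is bounded and `A` is
its bounded extension to `K_α`. -/
def EqATTO {α β : ℂ → ℂ} (A : modelSpace α →L[ℂ] modelSpace β) (φ : L2) : Prop :=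
  ∀ f : (atto α β φ).domain, A f = atto α β φ f

/-- `𝒯(α, β)`: the bounded asymmetric truncated Toeplitz operators from `K_α` to `K_β`. -/
def attoSpace (α β : ℂ → ℂ) : Set (modelSpace α →L[ℂ] modelSpace β) :=
  {A | ∃ φ : L2, EqATTO A φ}

/-- The function `α_w = (w - α) / (1 - conj w α)`. -/
def frostman (α : ℂ → ℂ) (w : ℂ) (z : ℂ) : ℂ := (w - α z) / (1 - conj w * α z)

theorem IsInner.ae_bdry {α : ℂ → ℂ} (hα : IsInner α) : ∀ᵐ t ∂circMeasure, ‖bdry α t‖ = 1 ∧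
    Tendsto (fun r : ℝ => α ((r : ℂ) * (AddCircle.toCircle t : ℂ))) (𝓝[<] (1 : ℝ))
      (𝓝 (bdry α t)) := by
  filter_upwards [hα.unimodular] with t ⟨l, hl, h⟩
  have : bdry α t = l := h.limUnder_eq
  rw [this]
  exact ⟨hl, h⟩

theorem norm_radius_mul (t : Circ) {r : ℝ} (h0 : 0 ≤ r) (h1 : r < 1) :
    (r : ℂ) * (AddCircle.toCircle t : ℂ) ∈ Metric.ball (0 : ℂ) 1 := by
  rw [mem_ball_zero_iff, norm_mul, Circle.norm_coe, Complex.norm_real, Real.norm_eq_abs,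
    abs_of_nonneg h0, mul_one]
  exact h1

theorem tendsto_radius : Tendsto (fun n : ℕ => 1 - 1 / ((n : ℝ) + 1)) atTop (𝓝[<] (1 : ℝ)) := by
  refine tendsto_nhdsWithin_iff.2 ⟨?_, Eventually.of_forall fun n => ?_⟩
  · simpa using tendsto_const_nhds.sub (tendsto_one_div_add_atTop_nhds_zero_nat (𝕜 := ℝ))
  · have : 0 < 1 / ((n : ℝ) + 1) := by positivity
    simp only [Set.mem_Iio]
    linarith

theorem radius_nonneg (n : ℕ) : 0 ≤ 1 - 1 / ((n : ℝ) + 1) := by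
  rw [sub_nonneg, div_le_one (by positivity)]
  have : (0 : ℝ) ≤ n := by positivity
  linarith

theorem radius_lt (n : ℕ) : 1 - 1 / ((n : ℝ) + 1) < 1 := by
  have : 0 < 1 / ((n : ℝ) + 1) := by positivity
  linarith

theorem IsInner.continuous_radial {α : ℂ → ℂ} (hα : IsInner α) {r : ℝ} (h0 : 0 ≤ r) (h1 : r < 1) :
    Continuous fun t : Circ => α ((r : ℂ) * (AddCircle.toCircle t : ℂ)) := by
  refine hα.analytic.continuousOn.comp_continuous ?_ fun t => norm_radius_mul t h0 h1
  have : Continuous (AddCircle.toCircle : Circ → Circle) := AddCircle.continuous_toCircle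
  fun_prop

theorem IsInner.aestronglyMeasurable {α : ℂ → ℂ} (hα : IsInner α) :
    AEStronglyMeasurable (bdry α) circMeasure := by
  refine aestronglyMeasurable_of_tendsto_ae atTop
    (f := fun (n : ℕ) (t : Circ) =>
      α (((1 - 1 / ((n : ℝ) + 1) : ℝ) : ℂ) * (AddCircle.toCircle t : ℂ)))
    (fun n => (hα.continuous_radial (radius_nonneg n) (radius_lt n)).aestronglyMeasurable) ?_
  filter_upwards [hα.ae_bdry] with t ht
  exact ht.2.comp tendsto_radius

theorem integral_radial_eq_zero {α : ℂ → ℂ} (hα : IsInner α) {r : ℝ} (h0 : 0 ≤ r) (h1 : r < 1)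
    {n : ℤ} (hn : n < 0) :
    fourierCoeff (fun t : Circ => α ((r : ℂ) * (AddCircle.toCircle t : ℂ))) n = 0 := by
  obtain ⟨k, rfl⟩ : ∃ k : ℕ, n = -((k : ℤ) + 1) := ⟨(-n - 1).toNat, by omega⟩
  rw [fourierCoeff_eq_intervalIntegral _ _ 0, zero_add]
  have key : (∮ z in C(0, 1), α ((r : ℂ) * z) * z ^ k) = 0 := by
    refine Complex.circleIntegral_eq_zero_of_differentiable_on_off_countable
      (s := ∅) zero_le_one Set.countable_empty ?_ ?_
    · refine ContinuousOn.mul ?_ (by fun_prop)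
      refine hα.analytic.continuousOn.comp (by fun_prop) ?_
      intro z hz
      simp only [Metric.mem_closedBall, dist_zero_right] at hz
      simp only [Metric.mem_ball, dist_zero_right, norm_mul, Complex.norm_real,
        Real.norm_eq_abs, abs_of_nonneg h0]
      nlinarith
    · intro z hz
      have hz' : ‖z‖ < 1 := by simpa using hz.1
      refine DifferentiableAt.mul ?_ (by fun_prop)
      refine DifferentiableAt.comp z (g := α) ?_ (by fun_prop)
      refine hα.analytic.differentiableAt (Metric.isOpen_ball.mem_nhds ?_)
      simp only [Metric.mem_ball, dist_zero_right, norm_mul, Complex.norm_real,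
        Real.norm_eq_abs, abs_of_nonneg h0]
      nlinarith [norm_nonneg z]
  have h2 : ∀ x : ℝ, deriv (circleMap 0 1) x • (α ((r : ℂ) * circleMap 0 1 x) *
      (circleMap 0 1 x) ^ k) = Complex.I * ((fourier (-(-((k : ℤ) + 1))) (x : Circ) : ℂ) •
      α ((r : ℂ) * (AddCircle.toCircle (x : Circ) : ℂ))) := by
    intro x
    have e : (AddCircle.toCircle (x : Circ) : ℂ) = circleMap 0 1 x := by
      rw [AddCircle.toCircle_apply_mk]
      simp [circleMap]
    have e2 : (fourier ((k : ℤ) + 1) (x : Circ) : ℂ) = circleMap 0 1 x ^ (k + 1) := by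
      rw [fourier_apply, ← e, AddCircle.toCircle_zsmul, ← Nat.cast_succ, zpow_natCast,
        Circle.coe_pow]
    rw [deriv_circleMap, smul_eq_mul, smul_eq_mul, neg_neg, e2, e]
    ring
  have h3 : Complex.I * (∫ x in (0 : ℝ)..2 * Real.pi, (fourier (-(-((k : ℤ) + 1))) (x : Circ) : ℂ) •
      α ((r : ℂ) * (AddCircle.toCircle (x : Circ) : ℂ))) = 0 := by
    rw [← intervalIntegral.integral_const_mul, ← key, circleIntegral]
    simp_rw [h2]
  rw [(mul_eq_zero.1 h3).resolve_left Complex.I_ne_zero, smul_zero]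

theorem IsInner.fourierCoeff_bdry {α : ℂ → ℂ} (hα : IsInner α) {n : ℤ} (hn : n < 0) :
    fourierCoeff (bdry α) n = 0 := by
  obtain ⟨C, hC⟩ := hα.bounded
  have h : Tendsto (fun m : ℕ => fourierCoeff (fun t : Circ =>
      α (((1 - 1 / ((m : ℝ) + 1) : ℝ) : ℂ) * (AddCircle.toCircle t : ℂ))) n) atTop
      (𝓝 (fourierCoeff (bdry α) n)) := by
    refine tendsto_integral_of_dominated_convergence (fun _ => C) (fun m => ?_)
      (integrable_const C) (fun m => Eventually.of_forall fun t => ?_) ?_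
    · exact (((fourier (-n)).continuous.smul
        (hα.continuous_radial (radius_nonneg m) (radius_lt m)))).aestronglyMeasurable
    · rw [norm_smul]
      have : ‖(fourier (-n) t : ℂ)‖ = 1 := by rw [fourier_apply, Circle.norm_coe]
      rw [this, one_mul]
      exact hC _ (norm_radius_mul t (radius_nonneg m) (radius_lt m))
    · filter_upwards [hα.ae_bdry] with t ht
      exact (ht.2.comp tendsto_radius).const_smul _
  refine tendsto_nhds_unique h ?_
  simp_rw [fun m : ℕ => integral_radial_eq_zero hα (radius_nonneg m) (radius_lt m) hn]
  exact tendsto_const_nhds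

theorem IsInner.memLp {α : ℂ → ℂ} (hα : IsInner α) : MemLp (bdry α) ∞ circMeasure :=
  memLp_top_of_bound hα.aestronglyMeasurable 1 (hα.ae_bdry.mono fun _ h => h.1.le)

theorem inner_mulOp {g h : Circ → ℂ} (hg : MemLp g ∞ circMeasure) (hh : MemLp h ∞ circMeasure)
    (hgh : ∀ᵐ t ∂circMeasure, h t = conj (g t)) (x y : L2) :
    inner ℂ (mulOp g hg x) y = inner ℂ x (mulOp h hh y) := by
  rw [L2.inner_def, L2.inner_def]
  refine integral_congr_ae ?_
  filter_upwards [mulOp_ae g hg x, mulOp_ae h hh y, hgh] with t h1 h2 h3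
  rw [h1, h2, h3]
  simp only [RCLike.inner_apply, map_mul]
  ring

theorem mem_hardy_iff (f : L2) :
    f ∈ hardy ↔ ∀ n : ℤ, n < 0 → inner ℂ (fourierLp 2 n : L2) f = 0 := by
  refine forall₂_congr fun n _ => ?_
  rw [← fourierBasis_repr, HilbertBasis.repr_apply_apply, coe_fourierBasis]

theorem IsInner.mul_mem_hardy {α : ℂ → ℂ} (hα : IsInner α) {f : L2} (hf : f ∈ hardy) :
    mulOp (bdry α) hα.memLp f ∈ hardy := by
  rw [mem_hardy_iff]
  intro n hn
  have hs : MemLp (fun t => conj (bdry α t)) ∞ circMeasure := hα.memLp.star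
  rw [← inner_mulOp hs hα.memLp (by simp), ← (fourierBasis (T := 2 * Real.pi)).tsum_inner_mul_inner]
  refine (tsum_congr fun m => ?_).trans tsum_zero
  rw [coe_fourierBasis]
  by_cases hm : m < 0
  · rw [(mem_hardy_iff f).1 hf m hm, mul_zero]
  · have h0 := hα.fourierCoeff_bdry (n := n - m) (by omega)
    suffices h : inner ℂ (mulOp _ hs (fourierLp 2 n)) (fourierLp 2 m : L2) = 0 by
      rw [h, zero_mul]
    rw [inner_mulOp hs hα.memLp (by simp), L2.inner_def, ← h0, fourierCoeff]
    refine integral_congr_ae ?_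
    filter_upwards [mulOp_ae (bdry α) hα.memLp (fourierLp 2 m), coeFn_fourierLp 2 m,
      coeFn_fourierLp (T := 2 * Real.pi) 2 n] with t h1 h2 h3
    rw [h1, h2, h3, neg_sub, sub_eq_add_neg, fourier_add, fourier_neg]
    simp only [RCLike.inner_apply, smul_eq_mul]
    ring

theorem one_sub_ne_zero {w u : ℂ} (hw : ‖w‖ < 1) (hu : ‖u‖ = 1) : 1 - conj w * u ≠ 0 := by
  intro h
  have h1 : conj w * u = 1 := (sub_eq_zero.1 h).symm
  have h2 : ‖conj w * u‖ = 1 := by rw [h1, norm_one]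
  rw [norm_mul, RCLike.norm_conj, hu, mul_one] at h2
  exact hw.ne h2

theorem le_norm_one_sub {w u : ℂ} (hu : ‖u‖ = 1) : 1 - ‖w‖ ≤ ‖1 - conj w * u‖ := by
  have h := norm_sub_norm_le 1 (conj w * u)
  rwa [norm_one, norm_mul, RCLike.norm_conj, hu, mul_one] at h

theorem sqrt_pos_of_norm_lt {w : ℂ} (hw : ‖w‖ < 1) : 0 < √(1 - ‖w‖ ^ 2) := by
  refine Real.sqrt_pos.2 ?_
  nlinarith [norm_nonneg w]

/-- The multiplier `√(1 - |w|²) / (1 - conj w α)` on the unit circle. -/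
def crofootMul (α : ℂ → ℂ) (w : ℂ) (t : Circ) : ℂ :=
  (√(1 - ‖w‖ ^ 2) : ℂ) / (1 - conj w * bdry α t)

/-- The reciprocal of the multiplier `crofootMul`. -/
def crofootInvMul (α : ℂ → ℂ) (w : ℂ) (t : Circ) : ℂ :=
  (1 - conj w * bdry α t) / (√(1 - ‖w‖ ^ 2) : ℂ)

theorem IsInner.memLp_crofootMul {α : ℂ → ℂ} (hα : IsInner α) {w : ℂ} (hw : ‖w‖ < 1) :
    MemLp (crofootMul α w) ∞ circMeasure := by
  refine memLp_top_of_bound (C := √(1 - ‖w‖ ^ 2) / (1 - ‖w‖)) ?_ ?_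
  · exact (aemeasurable_const.div (aemeasurable_const.sub
      (hα.aestronglyMeasurable.aemeasurable.const_mul _))).aestronglyMeasurable
  · filter_upwards [hα.ae_bdry] with t ht
    rw [crofootMul, norm_div, Complex.norm_real, Real.norm_of_nonneg (Real.sqrt_nonneg _)]
    exact div_le_div_of_nonneg_left (Real.sqrt_nonneg _) (by linarith) (le_norm_one_sub ht.1)

theorem IsInner.memLp_crofootInvMul {α : ℂ → ℂ} (hα : IsInner α) (w : ℂ) :
    MemLp (crofootInvMul α w) ∞ circMeasure := by
  have h := ((memLp_const (p := ∞) (μ := circMeasure) (1 : ℂ)).sub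
    (hα.memLp.const_mul (conj w))).const_mul ((√(1 - ‖w‖ ^ 2) : ℂ)⁻¹)
  refine (memLp_congr_ae (Eventually.of_forall fun t => ?_)).2 h
  simp only [crofootInvMul, Pi.sub_apply]
  rw [div_eq_inv_mul]

theorem IsInner.bdry_frostman {α : ℂ → ℂ} (hα : IsInner α) {w : ℂ} (hw : ‖w‖ < 1) :
    ∀ᵐ t ∂circMeasure, bdry (frostman α w) t = (w - bdry α t) / (1 - conj w * bdry α t) := by
  filter_upwards [hα.ae_bdry] with t ht
  exact ((tendsto_const_nhds.sub ht.2).div (tendsto_const_nhds.sub (ht.2.const_mul _))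
    (one_sub_ne_zero hw ht.1)).limUnder_eq

theorem IsInner.crofoot_mem_hardy {α : ℂ → ℂ} (hα : IsInner α) {w : ℂ} (hw : ‖w‖ < 1) {f : L2}
    (hf : f ∈ hardy) : mulOp (crofootMul α w) (hα.memLp_crofootMul hw) f ∈ hardy := by
  set g := mulOp (crofootMul α w) (hα.memLp_crofootMul hw) f with hg
  set U := mulOp (bdry α) hα.memLp with hU
  set c : ℂ := (√(1 - ‖w‖ ^ 2) : ℂ) with hc
  have hUn : ∀ x : L2, ‖U x‖ ≤ ‖x‖ := by
    intro x
    refine Lp.norm_le_norm_of_ae_le ?_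
    filter_upwards [hα.ae_bdry, mulOp_ae (bdry α) hα.memLp x] with t h1 h2
    rw [h2, norm_mul, h1.1, one_mul]
  have hfix : g = c • f + conj w • U g := by
    apply Lp.ext
    filter_upwards [hα.ae_bdry, mulOp_ae (bdry α) hα.memLp g,
      mulOp_ae (crofootMul α w) (hα.memLp_crofootMul hw) f, Lp.coeFn_add (c • f) (conj w • U g),
      Lp.coeFn_smul c f, Lp.coeFn_smul (conj w) (U g)] with t h1 h2 h3 h4 h5 h6
    rw [h4, Pi.add_apply, h5, h6, Pi.smul_apply, Pi.smul_apply, h2, h3, crofootMul]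
    have := one_sub_ne_zero hw h1.1
    simp only [smul_eq_mul, ← hc]
    field_simp
    ring
  set p : L2 := hardy.starProjection g with hp
  have hpm : p ∈ hardy := Submodule.starProjection_apply_mem _ _
  have hqm : c • f + conj w • U p ∈ hardy :=
    add_mem (Submodule.smul_mem _ _ hf) (Submodule.smul_mem _ _ (hα.mul_mem_hardy hpm))
  have h1 : ‖g - p‖ ≤ ‖g - (c • f + conj w • U p)‖ := by
    rw [hp, Submodule.starProjection_minimal]
    exact ciInf_le ⟨0, by rintro _ ⟨x, rfl⟩; exact norm_nonneg _⟩
      (⟨_, hqm⟩ : hardy)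
  have h2 : g - (c • f + conj w • U p) = conj w • U (g - p) := by
    rw [map_sub, smul_sub]
    nth_rewrite 1 [hfix]
    abel
  have h3 : ‖g - p‖ ≤ ‖w‖ * ‖g - p‖ := by
    refine h1.trans ?_
    rw [h2, norm_smul, RCLike.norm_conj]
    exact mul_le_mul_of_nonneg_left (hUn _) (norm_nonneg _)
  have h4 : ‖g - p‖ = 0 := by
    by_contra h
    have : 0 < ‖g - p‖ := lt_of_le_of_ne (norm_nonneg _) (Ne.symm h)
    nlinarith
  rw [sub_eq_zero.1 (norm_eq_zero.1 h4)]
  exact hpm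

theorem IsInner.crofootInv_mem_hardy {α : ℂ → ℂ} (hα : IsInner α) (w : ℂ) {f : L2}
    (hf : f ∈ hardy) : mulOp (crofootInvMul α w) (hα.memLp_crofootInvMul w) f ∈ hardy := by
  have h : mulOp (crofootInvMul α w) (hα.memLp_crofootInvMul w) f =
      (√(1 - ‖w‖ ^ 2) : ℂ)⁻¹ • (f - conj w • mulOp (bdry α) hα.memLp f) := by
    apply Lp.ext
    filter_upwards [mulOp_ae (bdry α) hα.memLp f,
      mulOp_ae (crofootInvMul α w) (hα.memLp_crofootInvMul w) f,
      Lp.coeFn_smul (√(1 - ‖w‖ ^ 2) : ℂ)⁻¹ (f - conj w • mulOp (bdry α) hα.memLp f),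
      Lp.coeFn_sub f (conj w • mulOp (bdry α) hα.memLp f),
      Lp.coeFn_smul (conj w) (mulOp (bdry α) hα.memLp f)] with t h1 h2 h3 h4 h5
    rw [h3, Pi.smul_apply, h4, Pi.sub_apply, h5, Pi.smul_apply, h1, h2, crofootInvMul]
    simp only [smul_eq_mul]
    ring
  rw [h]
  exact Submodule.smul_mem _ _ (sub_mem hf (Submodule.smul_mem _ _ (hα.mul_mem_hardy hf)))

/-- If `m H² ⊆ H²` and `conj m γ = -α m` on the circle, then multiplication by `m` maps the
orthogonal complement of `α H²` into that of `γ H²`. -/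
theorem mulOp_mem_orthogonal {α γ : ℂ → ℂ} {m : Circ → ℂ} (hm : MemLp m ∞ circMeasure)
    (hH : ∀ h ∈ hardy, mulOp m hm h ∈ hardy)
    (hrel : ∀ᵐ t ∂circMeasure, conj (m t) * bdry γ t = -(bdry α t * m t))
    {f : L2} (hf : f ∈ (mulHardy α)ᗮ) : mulOp m hm f ∈ (mulHardy γ)ᗮ := by
  rw [Submodule.mem_orthogonal]
  rintro k ⟨h, hh, hk⟩
  have hs : MemLp (fun t => conj (m t)) ∞ circMeasure := hm.star
  rw [← inner_mulOp hs hm (by simp)]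
  refine Submodule.mem_orthogonal _ _ |>.1 hf _ ⟨-mulOp m hm h, neg_mem (hH h hh), ?_⟩
  filter_upwards [mulOp_ae _ hs k, mulOp_ae m hm h, Lp.coeFn_neg (mulOp m hm h), hk, hrel]
    with t h1 h2 h3 h4 h5
  rw [h1, h3, Pi.neg_apply, h2, h4, ← mul_assoc, h5]
  ring

theorem IsInner.crofoot_mem {α : ℂ → ℂ} (hα : IsInner α) {w : ℂ} (hw : ‖w‖ < 1) {f : L2}
    (hf : f ∈ modelSpace α) :
    mulOp (crofootMul α w) (hα.memLp_crofootMul hw) f ∈ modelSpace (frostman α w) := by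
  refine ⟨hα.crofoot_mem_hardy hw hf.1,
    mulOp_mem_orthogonal _ (fun h hh => hα.crofoot_mem_hardy hw hh) ?_ hf.2⟩
  filter_upwards [hα.ae_bdry, hα.bdry_frostman hw] with t h1 h2
  have h3 := one_sub_ne_zero hw h1.1
  have h4 : conj (1 - conj w * bdry α t) ≠ 0 := (map_ne_zero _).2 h3
  have h5 : bdry α t * conj (bdry α t) = 1 := by
    rw [Complex.mul_conj, Complex.normSq_eq_norm_sq, h1.1]; simp
  rw [h2, crofootMul, map_div₀, Complex.conj_ofReal]
  simp only [map_sub, map_mul, map_one, Complex.conj_conj] at h4 ⊢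
  set d := 1 - conj w * bdry α t with hd
  set e := 1 - w * conj (bdry α t) with he
  have h7 : w - bdry α t = -(bdry α t * e) := by
    rw [he]
    linear_combination (-w) * h5
  rw [h7]
  field_simp

theorem IsInner.crofootInv_mem {α : ℂ → ℂ} (hα : IsInner α) {w : ℂ} (hw : ‖w‖ < 1) {f : L2}
    (hf : f ∈ modelSpace (frostman α w)) :
    mulOp (crofootInvMul α w) (hα.memLp_crofootInvMul w) f ∈ modelSpace α := by
  refine ⟨hα.crofootInv_mem_hardy w hf.1,
    mulOp_mem_orthogonal _ (fun h hh => hα.crofootInv_mem_hardy w hh) ?_ hf.2⟩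
  filter_upwards [hα.ae_bdry, hα.bdry_frostman hw] with t h1 h2
  have h3 := one_sub_ne_zero hw h1.1
  have h5 : bdry α t * conj (bdry α t) = 1 := by
    rw [Complex.mul_conj, Complex.normSq_eq_norm_sq, h1.1]; simp
  have h6 : (√(1 - ‖w‖ ^ 2) : ℂ) ≠ 0 := by exact_mod_cast (sqrt_pos_of_norm_lt hw).ne'
  rw [h2, crofootInvMul, map_div₀, Complex.conj_ofReal]
  simp only [map_sub, map_mul, map_one, Complex.conj_conj]
  set d := 1 - conj w * bdry α t with hd
  field_simp
  linear_combination (-w) * h5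

theorem IsInner.mulOp_crofootInv_crofoot {α : ℂ → ℂ} (hα : IsInner α) {w : ℂ} (hw : ‖w‖ < 1)
    (f : L2) : mulOp (crofootInvMul α w) (hα.memLp_crofootInvMul w)
      (mulOp (crofootMul α w) (hα.memLp_crofootMul hw) f) = f := by
  apply Lp.ext
  filter_upwards [hα.ae_bdry, mulOp_ae (crofootMul α w) (hα.memLp_crofootMul hw) f,
    mulOp_ae (crofootInvMul α w) (hα.memLp_crofootInvMul w)
      (mulOp (crofootMul α w) (hα.memLp_crofootMul hw) f)] with t h1 h2 h3
  have h4 := one_sub_ne_zero hw h1.1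
  have h5 : (√(1 - ‖w‖ ^ 2) : ℂ) ≠ 0 := by exact_mod_cast (sqrt_pos_of_norm_lt hw).ne'
  rw [h3, h2, crofootInvMul, crofootMul]
  set d := 1 - conj w * bdry α t with hd
  field_simp

theorem IsInner.mulOp_crofoot_crofootInv {α : ℂ → ℂ} (hα : IsInner α) {w : ℂ} (hw : ‖w‖ < 1)
    (f : L2) : mulOp (crofootMul α w) (hα.memLp_crofootMul hw)
      (mulOp (crofootInvMul α w) (hα.memLp_crofootInvMul w) f) = f := by
  apply Lp.ext
  filter_upwards [hα.ae_bdry, mulOp_ae (crofootInvMul α w) (hα.memLp_crofootInvMul w) f,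
    mulOp_ae (crofootMul α w) (hα.memLp_crofootMul hw)
      (mulOp (crofootInvMul α w) (hα.memLp_crofootInvMul w) f)] with t h1 h2 h3
  have h4 := one_sub_ne_zero hw h1.1
  have h5 : (√(1 - ‖w‖ ^ 2) : ℂ) ≠ 0 := by exact_mod_cast (sqrt_pos_of_norm_lt hw).ne'
  rw [h3, h2, crofootInvMul, crofootMul]
  set d := 1 - conj w * bdry α t with hd
  field_simp

/-- The Crofoot transform `J_w^α : K_α → K_{α_w}`, `f ↦ √(1 - |w|²) / (1 - conj w α) f`, as an
invertible bounded operator. -/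
def crofoot {α : ℂ → ℂ} (hα : IsInner α) {w : ℂ} (hw : ‖w‖ < 1) :
    modelSpace α ≃L[ℂ] modelSpace (frostman α w) :=
  ContinuousLinearEquiv.equivOfInverse
    ((mulOp (crofootMul α w) (hα.memLp_crofootMul hw)).restrict fun _ => hα.crofoot_mem hw)
    ((mulOp (crofootInvMul α w) (hα.memLp_crofootInvMul w)).restrict fun _ => hα.crofootInv_mem hw)
    (fun f => Subtype.ext (hα.mulOp_crofootInv_crofoot hw f))
    (fun f => Subtype.ext (hα.mulOp_crofoot_crofootInv hw f))

/-- The function `(1 - conj a α) (1 - b conj β) / (√(1 - |a|²) √(1 - |b|²))` on the unit circle. -/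
def symbolFactor (α β : ℂ → ℂ) (a b : ℂ) (t : Circ) : ℂ :=
  (1 - conj a * bdry α t) * (1 - b * conj (bdry β t)) /
    ((√(1 - ‖a‖ ^ 2) : ℂ) * (√(1 - ‖b‖ ^ 2) : ℂ))

theorem memLp_symbolFactor {α β : ℂ → ℂ} (hα : IsInner α) (hβ : IsInner β) (a b : ℂ) :
    MemLp (symbolFactor α β a b) ∞ circMeasure := by
  have h : MemLp ((fun t => conj (crofootInvMul β b t)) * crofootInvMul α a) ∞ circMeasure :=
    (hα.memLp_crofootInvMul a).mul (hβ.memLp_crofootInvMul b).star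
  refine (memLp_congr_ae (Eventually.of_forall fun t => ?_)).2 h
  simp only [symbolFactor, crofootInvMul, Pi.mul_apply, map_div₀, map_sub, map_mul, map_one,
    Complex.conj_conj, Complex.conj_ofReal]
  rw [div_mul_div_comm]
  ring

/-- The symbol `(1 - conj a α) (1 - b conj β) φ / (√(1 - |a|²) √(1 - |b|²))`. -/
def crofootSymbol {α β : ℂ → ℂ} (hα : IsInner α) (hβ : IsInner β) (a b : ℂ) (φ : L2) : L2 :=
  mulOp (symbolFactor α β a b) (memLp_symbolFactor hα hβ a b) φ

end ATTO

end

/-! ### Unitarity of the Crofoot transform. -/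

namespace ATTO

/-! The Crofoot transform is unitary, and conjugating by it only multiplies symbols. On the circle
the squared modulus of the multiplier is the Poisson kernel `1 + w̄α/(1 - w̄α) + wᾱ/(1 - wᾱ)`.
Paired between two elements of `K_α`, the last two terms vanish, because `1/(1 - w̄α)` preserves
`H²` and `K_α` is orthogonal to `αH²` (`IsInner.inner_crofootMul`). Hence the adjoint of `J_w` is
its inverse, which is multiplication by the reciprocal of the multiplier and not by its conjugate.

With `s` and `n` the reciprocal multipliers for `α` and `β`, every bounded `f` in `K_{α_a}` and
every `k` in `K_{β_b}` satisfy `⟨J_b A J_a⁻¹ f, k⟩ = ⟨A(s f), n k⟩ = ⟨φ s f, n k⟩ = ⟨n̄ s φ f, k⟩`.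
The projections drop out because `n k` and `k` lie in the model spaces. `EqATTO.comp` is this
computation for general multiplication operators, and `n̄ s φ` is the asserted symbol. The converse
applies it again to the inverse transforms. -/

/-- The Crofoot multiplier preserves the inner product of a function in `K_α` with another one,
since its squared modulus is a Poisson kernel. -/
theorem IsInner.inner_crofootMul {α : ℂ → ℂ} (hα : IsInner α) {w : ℂ} (hw : ‖w‖ < 1) {x y : L2}
    (hx : x ∈ modelSpace α) (hy : y ∈ modelSpace α) :
    inner ℂ (mulOp (crofootMul α w) (hα.memLp_crofootMul hw) x)
      (mulOp (crofootMul α w) (hα.memLp_crofootMul hw) y) = inner ℂ x y := by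
  set c : ℂ := (√(1 - ‖w‖ ^ 2) : ℂ) with hc
  have hc0 : c ≠ 0 := Complex.ofReal_ne_zero.2 (sqrt_pos_of_norm_lt hw).ne'
  have hc2 : c * c = 1 - w * conj w := by
    rw [hc, ← Complex.ofReal_mul, Real.mul_self_sqrt (by nlinarith [norm_nonneg w]),
      Complex.mul_conj, Complex.normSq_eq_norm_sq]
    push_cast
    ring
  set M := mulOp (crofootMul α w) (hα.memLp_crofootMul hw) with hM
  set U := mulOp (bdry α) hα.memLp with hU
  -- Since `M` preserves `H²`, the function `αMz` lies in `αH²`, so it is orthogonal to `K_α`.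
  have hmem : ∀ z ∈ modelSpace α, U (M z) ∈ mulHardy α := fun z hz =>
    ⟨M z, hα.crofoot_mem_hardy hw hz.1, mulOp_ae _ _ _⟩
  have h1 : inner ℂ (U (M x)) y = 0 := Submodule.mem_orthogonal _ _ |>.1 hy.2 _ (hmem x hx)
  have h2 : inner ℂ x (U (M y)) = 0 := Submodule.mem_orthogonal' _ _ |>.1 hx.2 _ (hmem y hy)
  have hs : MemLp (fun t => conj (crofootMul α w t)) ∞ circMeasure :=
    (hα.memLp_crofootMul hw).star
  have hu : MemLp (fun t => conj (bdry α t)) ∞ circMeasure := hα.memLp.star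
  -- The Poisson kernel expansion applied to `y`; dividing by `c` turns the multiplier `c/(1 - w̄α)`
  -- into `1/(1 - w̄α)`.
  have key : mulOp _ hs (M y) =
      y + ((conj w * c⁻¹) • U (M y) + (w * c⁻¹) • mulOp _ hs (mulOp _ hu y)) := by
    apply Lp.ext
    filter_upwards [hα.ae_bdry, mulOp_ae _ hs (M y), mulOp_ae _ (hα.memLp_crofootMul hw) y,
      Lp.coeFn_add y ((conj w * c⁻¹) • U (M y) + (w * c⁻¹) • mulOp _ hs (mulOp _ hu y)),
      Lp.coeFn_add ((conj w * c⁻¹) • U (M y)) ((w * c⁻¹) • mulOp _ hs (mulOp _ hu y)),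
      Lp.coeFn_smul (conj w * c⁻¹) (U (M y)),
      Lp.coeFn_smul (w * c⁻¹) (mulOp _ hs (mulOp _ hu y)),
      mulOp_ae _ hα.memLp (M y), mulOp_ae _ hs (mulOp _ hu y), mulOp_ae _ hu y]
      with t k1 k2 k3 k4 k5 k6 k7 k8 k9 k10
    rw [k4, Pi.add_apply, k5, Pi.add_apply, k6, k7, Pi.smul_apply, Pi.smul_apply, k8, k9, k10,
      k2, k3, crofootMul, ← hc]
    have h3 := one_sub_ne_zero hw k1.1
    have h4 : conj (1 - conj w * bdry α t) ≠ 0 := (map_ne_zero _).2 h3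
    have h5 : bdry α t * conj (bdry α t) = 1 := by
      rw [Complex.mul_conj, Complex.normSq_eq_norm_sq, k1.1]; simp
    rw [map_div₀, hc, Complex.conj_ofReal, ← hc]
    simp only [map_sub, map_mul, map_one, Complex.conj_conj, smul_eq_mul] at h4 ⊢
    field_simp
    -- Only `c² = 1 - |w|²` and `|α| = 1` remain to be used.
    linear_combination (y t : ℂ) * hc2 + (y t : ℂ) * w * conj w * h5
  -- The analytic term pairs with `x` to zero by `h2`. The conjugate-analytic one becomes `⟨αMx, y⟩`
  -- after both factors move to the left, and vanishes by `h1`.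
  rw [inner_mulOp (hα.memLp_crofootMul hw) hs (by simp), key, inner_add_right, inner_add_right,
    inner_smul_right, inner_smul_right, h2,
    ← inner_mulOp (hα.memLp_crofootMul hw) hs (by simp), ← inner_mulOp hα.memLp hu (by simp),
    h1]
  ring

/-- Writing `k` as the transform of its inverse image reduces this to unitarity. The relation is
special to the model spaces: on all of `L²` the adjoint is multiplication by the conjugate. -/
theorem IsInner.inner_crofootMul_left {α : ℂ → ℂ} (hα : IsInner α) {w : ℂ} (hw : ‖w‖ < 1)
    {x k : L2} (hx : x ∈ modelSpace α) (hk : k ∈ modelSpace (frostman α w)) :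
    inner ℂ (mulOp (crofootMul α w) (hα.memLp_crofootMul hw) x) k =
      inner ℂ x (mulOp (crofootInvMul α w) (hα.memLp_crofootInvMul w) k) := by
  rw [← hα.inner_crofootMul hw hx (hα.crofootInv_mem hw hk), hα.mulOp_crofoot_crofootInv hw]

theorem IsInner.inner_crofootInvMul_left {α : ℂ → ℂ} (hα : IsInner α) {w : ℂ} (hw : ‖w‖ < 1)
    {x k : L2} (hx : x ∈ modelSpace (frostman α w)) (hk : k ∈ modelSpace α) :
    inner ℂ (mulOp (crofootInvMul α w) (hα.memLp_crofootInvMul w) x) k =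
      inner ℂ x (mulOp (crofootMul α w) (hα.memLp_crofootMul hw) k) := by
  rw [← hα.inner_crofootMul hw (hα.crofootInv_mem hw hx) hk, hα.mulOp_crofoot_crofootInv hw]

/-! ### Symbols under composition with multiplication operators. -/

theorem memLp_mulOp {s : Circ → ℂ} (hs : MemLp s ∞ circMeasure) {f : L2}
    (hf : MemLp f ∞ circMeasure) : MemLp (mulOp s hs f) ∞ circMeasure :=
  (memLp_congr_ae (mulOp_ae s hs f)).2 (hf.mul hs)

/-- Composing an asymmetric truncated Toeplitz operator with multiplication operators `S` by `s`
and `T` by `m`, where multiplication by `n` is the adjoint of `T`, multiplies its symbol by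
`conj n * s`. -/
theorem EqATTO.comp {α β γ δ : ℂ → ℂ} {A : modelSpace α →L[ℂ] modelSpace β} {φ ψ : L2}
    (hA : EqATTO A φ) {s m n : Circ → ℂ} (hs : MemLp s ∞ circMeasure)
    (hm : MemLp m ∞ circMeasure) (hn : MemLp n ∞ circMeasure)
    {S : modelSpace γ →L[ℂ] modelSpace α} {T : modelSpace β →L[ℂ] modelSpace δ}
    (hS : ∀ x, (S x : L2) = mulOp s hs x) (hT : ∀ x, (T x : L2) = mulOp m hm x)
    (hnmem : ∀ k ∈ modelSpace δ, mulOp n hn k ∈ modelSpace β)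
    (hadj : ∀ x ∈ modelSpace β, ∀ k ∈ modelSpace δ,
      inner ℂ (mulOp m hm x) k = inner ℂ x (mulOp n hn k))
    (hψ : ψ =ᵐ[circMeasure] fun t => conj (n t) * s t * φ t) :
    EqATTO (T ∘L A ∘L S) ψ := by
  intro f
  have hf : MemLp ((f : modelSpace γ) : L2) ∞ circMeasure := f.2
  have hSf : S f ∈ boundedPart α := by
    change MemLp (S f : L2) ∞ circMeasure
    rw [hS]
    exact memLp_mulOp hs hf
  -- The hypothesis on `A` concerns bounded functions only; it applies to `S f` because `s` is
  -- bounded.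
  have hAf : A (S f) = (modelSpace β).orthogonalProjectionOnto (mulOp (S f : L2) hSf φ) :=
    hA ⟨S f, hSf⟩
  change T (A (S f)) = (modelSpace δ).orthogonalProjectionOnto (mulOp _ hf ψ)
  refine ext_inner_right ℂ fun k => ?_
  have hc : MemLp (fun t => conj (n t)) ∞ circMeasure := hn.star
  -- Testing against `k` in `K_δ` removes the outer projection, and the adjoint relation moves `T`
  -- onto `k`.
  rw [Submodule.inner_orthogonalProjectionOnto_eq_of_mem_right, Submodule.coe_inner, hT,
    hadj _ (A (S f)).2 _ k.2, hAf]
  -- The projection onto `K_β` also disappears, since `n k` lies in `K_β`.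
  have h := Submodule.inner_orthogonalProjectionOnto_eq_of_mem_right
    (K := modelSpace β) ⟨_, hnmem k k.2⟩ (mulOp (S f : L2) hSf φ)
  rw [Submodule.coe_inner] at h
  refine h.trans ?_
  rw [← inner_mulOp hc hn (by simp)]
  congr 1
  apply Lp.ext
  have hSae : (S f : L2) =ᵐ[circMeasure] fun t => s t * ((f : modelSpace γ) : L2) t := by
    rw [hS]
    exact mulOp_ae _ _ _
  filter_upwards [hψ, hSae, mulOp_ae _ hc (mulOp (S f : L2) hSf φ), mulOp_ae _ hSf φ,
    mulOp_ae _ hf ψ] with t h1 h2 h3 h4 h5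
  rw [h3, h4, h5, h1, h2]
  ring

/-! ### Conjugation by Crofoot transforms. -/

theorem EqATTO.crofoot {α β : ℂ → ℂ} (hα : IsInner α) (hβ : IsInner β) {a b : ℂ} (ha : ‖a‖ < 1)
    (hb : ‖b‖ < 1) {A : modelSpace α →L[ℂ] modelSpace β} {φ : L2} (hA : EqATTO A φ) :
    EqATTO ((crofoot hβ hb).toContinuousLinearMap ∘L A ∘L
      (crofoot hα ha).symm.toContinuousLinearMap) (crofootSymbol hα hβ a b φ) := by
  refine hA.comp (hα.memLp_crofootInvMul a) (hβ.memLp_crofootMul hb) (hβ.memLp_crofootInvMul b)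
    (fun _ => rfl) (fun _ => rfl) (fun _ hk => hβ.crofootInv_mem hb hk)
    (fun _ hx _ hk => hβ.inner_crofootMul_left hb hx hk) ?_
  filter_upwards [mulOp_ae _ (memLp_symbolFactor hα hβ a b) φ] with t h
  rw [crofootSymbol, h]
  -- The symbol factor is the conjugate reciprocal multiplier of `β` times the reciprocal multiplier
  -- of `α`.
  simp only [symbolFactor, crofootInvMul, map_div₀, map_sub, map_mul, map_one,
    Complex.conj_conj, Complex.conj_ofReal]
  rw [div_mul_div_comm]
  ring

/-- The roles of multiplier and reciprocal are exchanged, so the new factor is almost everywhere the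
reciprocal of `symbolFactor α β a b`. -/
theorem EqATTO.crofoot_symm {α β : ℂ → ℂ} (hα : IsInner α) (hβ : IsInner β) {a b : ℂ}
    (ha : ‖a‖ < 1) (hb : ‖b‖ < 1)
    {B : modelSpace (frostman α a) →L[ℂ] modelSpace (frostman β b)} {ψ : L2}
    (hB : EqATTO B ψ) :
    EqATTO ((ATTO.crofoot hβ hb).symm.toContinuousLinearMap ∘L B ∘L
        (ATTO.crofoot hα ha).toContinuousLinearMap)
      (mulOp _ (hβ.memLp_crofootMul hb).star (mulOp _ (hα.memLp_crofootMul ha) ψ)) := by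
  refine hB.comp (hα.memLp_crofootMul ha) (hβ.memLp_crofootInvMul b) (hβ.memLp_crofootMul hb)
    (fun _ => rfl) (fun _ => rfl) (fun _ hk => hβ.crofoot_mem hb hk)
    (fun _ hx _ hk => hβ.inner_crofootInvMul_left hb hx hk) ?_
  filter_upwards [mulOp_ae _ (hβ.memLp_crofootMul hb).star (mulOp _ (hα.memLp_crofootMul ha) ψ),
    mulOp_ae _ (hα.memLp_crofootMul ha) ψ] with t h1 h2
  rw [h1, h2, ← mul_assoc]
  rfl

end ATTO

theorem mainTheorem3 {α β : ℂ → ℂ} (hα : ATTO.IsInner α) (hβ : ATTO.IsInner β)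
    {a b : ℂ} (ha : ‖a‖ < 1) (hb : ‖b‖ < 1)
    (A : ATTO.modelSpace α →L[ℂ] ATTO.modelSpace β) :
    (A ∈ ATTO.attoSpace α β ↔
      (ATTO.crofoot hβ hb).toContinuousLinearMap ∘L A ∘L
          (ATTO.crofoot hα ha).symm.toContinuousLinearMap ∈
        ATTO.attoSpace (ATTO.frostman α a) (ATTO.frostman β b)) ∧
    ∀ φ : ATTO.L2, ATTO.EqATTO A φ →
      ATTO.EqATTO
        ((ATTO.crofoot hβ hb).toContinuousLinearMap ∘L A ∘L
          (ATTO.crofoot hα ha).symm.toContinuousLinearMap)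
        (ATTO.crofootSymbol hα hβ a b φ) := by
  refine ⟨⟨fun ⟨φ, hφ⟩ => ⟨_, hφ.crofoot hα hβ ha hb⟩, fun ⟨ψ, hψ⟩ => ?_⟩,
    fun φ hφ => hφ.crofoot hα hβ ha hb⟩
  -- Conjugating back recovers `A`, so the symbol supplied by `EqATTO.crofoot_symm` is a symbol of
  -- `A`.
  refine ⟨_, fun f => Eq.trans ?_ (hψ.crofoot_symm hα hβ ha hb f)⟩
  simp
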